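/- Let $n\ge 0$ and let $(M,\Phi,\xi,\eta,g)$ be a $(2n+1)$-dimensional Kenmotsu manifold: $M$ is a smooth manifold with smooth Riemannian metric $g$ and Levi-Civita connection $\nabla$, $\Phi$ is a smooth $(1,1)$-tensor field, $\xi$ a smooth vector field and $\eta$ a smooth $1$-form such that for all vector fields $X,Y$ $$\Phi^2X=-X+\eta(X)\xi,\quad \eta\circ\Phi=0,\quad \Phi\xi=0,\quad \eta(\xi)=1,\quad g(X,\xi)=\eta(X),$$ $$g(\Phi X,\Phi Y)=g(X,Y)-\eta(X)\eta(Y),\qquad g(X,\Phi Y)=-g(\Phi X,Y),$$ $$(\nabla_X\Phi)Y=-g(X,\Phi Y)\xi-\eta(Y)\Phi X,\qquad \nabla_X\xi=X-\eta(X)\xi .$$ Let $R(X,Y)Z=\nabla_X\nabla_YZ-\nabla_Y\nabla_XZ-\nabla_{[X,Y]}Z$ be the curvature tensor, $S(X,Y)=\operatorname{Tr}\{Z\mapsto R(Z,X)Y\}$ the Ricci tensor, $r=\operatorname{Tr}_g S$ the scalar curvature, $S^*(X,Y)=\tfrac12\operatorname{Tr}\{Z\mapsto \Phi\,R(X,\Phi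 Y)Z\}$ the $*$-Ricci tensor, and $r^*=\operatorname{Tr}_g S^*$ the $*$-scalar curvature. Suppose that $g$ is a $*$-Ricci–Bourguignon soliton $(g,z,\Omega,\omega)$, that is, $z$ is a smooth vector field on $M$ and $\Omega,\omega\in\mathbb R$ are constants with $$\mathcal L_zg+2S^*=2(\Omega+\omega r^*)\,g .$$ Then $g$ is an $\eta$-Ricci–Bourguignon soliton $(g,z,\Lambda,\mu,\omega)$, that is, $$\mathcal L_zg+2S=2\Lambda g+2\omega r\,g+2\mu\,\eta\otimes\eta ,$$ with the constants $\Lambda=\Omega-(2n-1)+4\omega n^2$ and $\mu=-1$. -/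

import Mathlib

open Bundle VectorField FiberBundle
open scoped Manifold ContDiff Topology

namespace KenmotsuGeometry

noncomputable section

variable {E : Type*} [NormedAddCommGroup E] [NormedSpace ℝ E] [FiniteDimensional ℝ E]
  {H : Type*} [TopologicalSpace H] (I : ModelWithCorners ℝ E H)
  {M : Type*} [TopologicalSpace M] [ChartedSpace H M] [IsManifold I ∞ M]
  [RiemannianBundle (fun x : M ↦ TangentSpace I x)]
  [IsContMDiffRiemannianBundle I ∞ E (fun x : M ↦ TangentSpace I x)]

/-- The right-hand side of Koszul's formula for `2 g(∇_X Z, W)`; here `g` is the inner product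
`inner ℝ` on tangent spaces, `mvfderiv I f x v` is the derivative `df_x(v)` of a real function, and
`mlieBracket` is the Lie bracket of vector fields. -/
def koszul (Z X W : Π x : M, TangentSpace I x) (x : M) : ℝ :=
  mvfderiv I (fun y ↦ inner ℝ (Z y) (W y)) x (X x)
    + mvfderiv I (fun y ↦ inner ℝ (W y) (X y)) x (Z x)
    - mvfderiv I (fun y ↦ inner ℝ (X y) (Z y)) x (W x)
    - inner ℝ (X x) (mlieBracket I Z W x)
    - inner ℝ (Z x) (mlieBracket I X W x)
    + inner ℝ (W x) (mlieBracket I X Z x)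

theorem md_inner {X Y : Π x : M, TangentSpace I x} {x : M} (hX : MDiffAt (T% X) x)
    (hY : MDiffAt (T% Y) x) : MDiffAt (fun y ↦ inner ℝ (X y) (Y y)) x := by
  have : IsContMDiffRiemannianBundle I 1 E (fun x : M ↦ TangentSpace I x) := inferInstance
  exact MDifferentiableAt.inner_bundle (E := fun x : M ↦ TangentSpace I x) hX hY

theorem koszul_tensorial₁ {Z W : Π x : M, TangentSpace I x} {x : M} (hZ : MDiffAt (T% Z) x)
    (hW : MDiffAt (T% W) x) : TensorialAt I E (fun X ↦ koszul I Z X W x) x where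
  smul {f X} hf hX := by
    simp only [koszul, Pi.smul_apply', real_inner_smul_left, real_inner_smul_right]
    rw [mlieBracket_smul_left hf hX, mlieBracket_smul_left hf hX,
      mvfderiv_fun_mul hf (md_inner I hW hX), mvfderiv_fun_mul hf (md_inner I hX hZ)]
    simp only [inner_add_right, real_inner_smul_right, map_smul, smul_eq_mul,
      add_apply, smul_apply, neg_smul, inner_neg_right]
    rw [real_inner_comm (X x) (Z x), real_inner_comm (X x) (W x)]
    ring
  add {X X'} hX hX' := by
    simp [koszul, mlieBracket_add_left hX hX', inner_add_left, inner_add_right,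
      mvfderiv_fun_add (md_inner I hW hX) (md_inner I hW hX'),
      mvfderiv_fun_add (md_inner I hX hZ) (md_inner I hX' hZ)]
    ring

theorem koszul_tensorial₂ {Z X : Π x : M, TangentSpace I x} {x : M} (hZ : MDiffAt (T% Z) x)
    (hX : MDiffAt (T% X) x) : TensorialAt I E (fun W ↦ koszul I Z X W x) x where
  smul {f W} hf hW := by
    simp only [koszul, Pi.smul_apply', real_inner_smul_left, real_inner_smul_right]
    rw [mlieBracket_smul_right hf hW, mlieBracket_smul_right hf hW,
      mvfderiv_fun_mul hf (md_inner I hW hX), mvfderiv_fun_mul hf (md_inner I hZ hW)]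
    simp only [inner_add_right, real_inner_smul_right, map_smul, smul_eq_mul,
      add_apply, smul_apply, neg_mul, neg_smul, inner_neg_right]
    rw [real_inner_comm (X x) (W x)]
    ring
  add {W W'} hW hW' := by
    simp [koszul, mlieBracket_add_right hW hW', inner_add_left, inner_add_right,
      mvfderiv_fun_add (md_inner I hW hX) (md_inner I hW' hX),
      mvfderiv_fun_add (md_inner I hZ hW) (md_inner I hZ hW')]
    ring

instance (x : M) : FiniteDimensional ℝ (TangentSpace I x) := inferInstanceAs (FiniteDimensional ℝ E)

open scoped Classical in
/-- Koszul's right-hand side at a point, as a bilinear form in `(X x, W x)`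
(zero if `Z` is not differentiable at `x`). -/
def koszulForm (Z : Π x : M, TangentSpace I x) (x : M) :
    TangentSpace I x →L[ℝ] TangentSpace I x →L[ℝ] ℝ :=
  if hZ : MDiffAt (T% Z) x then
    TensorialAt.mkHom₂ (fun X W ↦ koszul I Z X W x) x
      (fun _ hW ↦ koszul_tensorial₁ I hZ hW) (fun _ hX ↦ koszul_tensorial₂ I hZ hX)
  else 0

/-- `leviCivitaFun I Z x v` is `(∇_v Z)(x)`: the tangent vector representing half of
`koszulForm I Z x v` through the metric. -/
def leviCivitaFun (Z : Π x : M, TangentSpace I x) (x : M) :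
    TangentSpace I x →L[ℝ] TangentSpace I x :=
  LinearMap.toContinuousLinearMap
    { toFun := fun v ↦ (1 / 2 : ℝ) •
        (InnerProductSpace.toDual ℝ (TangentSpace I x)).symm (koszulForm I Z x v)
      map_add' := fun v w ↦ by simp
      map_smul' := fun c v ↦ by simp [smul_comm c] }

theorem inner_leviCivitaFun {Z X W : Π x : M, TangentSpace I x} {x : M}
    (hZ : MDiffAt (T% Z) x) (hX : MDiffAt (T% X) x) (hW : MDiffAt (T% W) x) :
    2 * inner ℝ (leviCivitaFun I Z x (X x)) (W x) = koszul I Z X W x := by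
  have h := TensorialAt.mkHom₂_apply (fun _ hW ↦ koszul_tensorial₁ I hZ hW)
    (fun _ hX ↦ koszul_tensorial₂ I hZ hX) hX hW
  simp [leviCivitaFun, inner_smul_left, koszulForm, hZ, h]

theorem koszul_add {Z Z' X W : Π x : M, TangentSpace I x} {x : M} (hZ : MDiffAt (T% Z) x)
    (hZ' : MDiffAt (T% Z') x) (hX : MDiffAt (T% X) x) (hW : MDiffAt (T% W) x) :
    koszul I (Z + Z') X W x = koszul I Z X W x + koszul I Z' X W x := by
  simp [koszul, mlieBracket_add_right hZ hZ', mlieBracket_add_left hZ hZ', inner_add_left,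
    inner_add_right,
    mvfderiv_fun_add (md_inner I hZ hW) (md_inner I hZ' hW),
    mvfderiv_fun_add (md_inner I hX hZ) (md_inner I hX hZ')]
  ring

theorem koszul_smul {f : M → ℝ} {Z X W : Π x : M, TangentSpace I x} {x : M}
    (hf : MDiffAt f x) (hZ : MDiffAt (T% Z) x) (hX : MDiffAt (T% X) x) (hW : MDiffAt (T% W) x) :
    koszul I (f • Z) X W x =
      f x * koszul I Z X W x + 2 * (mvfderiv I f x (X x) * inner ℝ (Z x) (W x)) := by
  simp only [koszul, Pi.smul_apply', real_inner_smul_left, real_inner_smul_right]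
  rw [mlieBracket_smul_right hf hZ, mlieBracket_smul_left hf hZ,
    mvfderiv_fun_mul hf (md_inner I hZ hW), mvfderiv_fun_mul hf (md_inner I hX hZ)]
  simp only [inner_add_right, real_inner_smul_right, map_smul, smul_eq_mul,
    add_apply, smul_apply, neg_mul, neg_smul, inner_neg_right]
  rw [real_inner_comm (Z x) (X x), real_inner_comm (Z x) (W x)]
  ring

theorem leviCivitaFun_isCov : IsCovariantDerivativeOn E (leviCivitaFun I (M := M)) where
  add {Z Z' x} hZ hZ' _ := by
    ext v
    apply ext_inner_right ℝ
    intro w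
    have hv := mdifferentiableAt_extend I E v
    have hw := mdifferentiableAt_extend I E w
    have h1 := inner_leviCivitaFun I hZ hv hw
    have h2 := inner_leviCivitaFun I hZ' hv hw
    have h3 := inner_leviCivitaFun I (mdifferentiableAt_add_section hZ hZ') hv hw
    have h4 := koszul_add I hZ hZ' hv hw
    simp only [extend_apply_self] at h1 h2 h3
    rw [add_apply, inner_add_left]
    change 2 * inner ℝ (leviCivitaFun I (Z + Z') x v) w = _ at h3
    linarith
  leibniz {Z f x} hZ hf _ := by
    ext v
    apply ext_inner_right ℝ
    intro w
    have hv := mdifferentiableAt_extend I E v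
    have hw := mdifferentiableAt_extend I E w
    have h1 := inner_leviCivitaFun I hZ hv hw
    have h3 := inner_leviCivitaFun I (hf.smul_section hZ) hv hw
    have h4 := koszul_smul I hf hZ hv hw
    simp only [extend_apply_self] at h1 h3 h4
    simp only [add_apply, smul_apply, inner_add_left, real_inner_smul_left,
      ContinuousLinearMap.smulRight_apply]
    change 2 * inner ℝ (leviCivitaFun I (f • Z) x v) w = _ at h3
    rw [← h1] at h4
    linarith

/-- The Levi-Civita connection: `leviCivita I Z x v` is `(∇_v Z)(x)`. -/
def leviCivita : CovariantDerivative I E (fun x : M ↦ TangentSpace I x) where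
  toFun := leviCivitaFun I
  isCovariantDerivativeOnUniv := leviCivitaFun_isCov I

/-- The Levi-Civita connection is torsion-free. -/
theorem leviCivita_torsion : (leviCivita I (M := M)).torsion = 0 := by
  rw [CovariantDerivative.torsion_eq_zero_iff]
  intro X Y x hX hY
  apply ext_inner_right ℝ
  intro w
  have hw := mdifferentiableAt_extend I E w
  have h1 := inner_leviCivitaFun I hY hX hw
  have h2 := inner_leviCivitaFun I hX hY hw
  simp only [extend_apply_self] at h1 h2
  simp only [koszul, real_inner_comm (X _) (Y _), real_inner_comm (Y _) (extend E w _),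
    real_inner_comm (X _) (extend E w _), extend_apply_self] at h1 h2
  rw [mlieBracket_swap_apply (V := Y) (W := X), inner_neg_right] at h2
  rw [inner_sub_left, real_inner_comm w (mlieBracket I X Y x)]
  change inner ℝ (leviCivitaFun I Y x (X x)) w - inner ℝ (leviCivitaFun I X x (Y x)) w = _
  linarith

/-- The Levi-Civita connection is compatible with the metric. -/
theorem leviCivita_metric {X Y Z : Π x : M, TangentSpace I x} {x : M}
    (hX : MDiffAt (T% X) x) (hY : MDiffAt (T% Y) x) (hZ : MDiffAt (T% Z) x) :
    mvfderiv I (fun y ↦ inner ℝ (Y y) (Z y)) x (X x) =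
      inner ℝ (leviCivita I Y x (X x)) (Z x) + inner ℝ (Y x) (leviCivita I Z x (X x)) := by
  have h1 := inner_leviCivitaFun I hY hX hZ
  have h2 := inner_leviCivitaFun I hZ hX hY
  change _ = inner ℝ (leviCivitaFun I Y x (X x)) (Z x) + inner ℝ (Y x) (leviCivitaFun I Z x (X x))
  rw [real_inner_comm (leviCivitaFun I Z x (X x)) (Y x)]
  simp only [koszul, real_inner_comm (X _) (Y _), real_inner_comm (Y _) (Z _),
    real_inner_comm (X _) (Z _)] at h1 h2
  rw [mlieBracket_swap_apply (V := Z) (W := Y), inner_neg_right] at h2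
  linarith

/-- The curvature `R(X, Y)Z = ∇_X ∇_Y Z - ∇_Y ∇_X Z - ∇_[X,Y] Z` of vector fields. -/
def curvature (X Y Z : Π x : M, TangentSpace I x) (x : M) : TangentSpace I x :=
  leviCivita I (fun y ↦ leviCivita I Z y (Y y)) x (X x)
    - leviCivita I (fun y ↦ leviCivita I Z y (X y)) x (Y x)
    - leviCivita I Z x (mlieBracket I X Y x)

/-- The curvature tensor `R(u, v)w` on tangent vectors at `x`, computed on the extensions of
`u, v, w` to vector fields that are constant in the preferred trivialization at `x`, hence smooth
near `x`. -/
def curvatureAt (x : M) (u v w : TangentSpace I x) : TangentSpace I x :=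
  curvature I (extend E u) (extend E v) (extend E w) x

/-- The trace of a bilinear form on `T_x M` with respect to the metric: the sum of `B (e i) (e i)`
over an orthonormal basis `e` of `T_x M`. -/
def metricTrace (x : M) (B : TangentSpace I x → TangentSpace I x → ℝ) : ℝ :=
  ∑ i, B (stdOrthonormalBasis ℝ (TangentSpace I x) i) (stdOrthonormalBasis ℝ (TangentSpace I x) i)

/-- The Ricci tensor `S(u, v) = Tr (w ↦ R(w, u)v)`. -/
def ricci (x : M) (u v : TangentSpace I x) : ℝ :=
  metricTrace I x fun e f ↦ inner ℝ (curvatureAt I x e u v) f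

/-- The scalar curvature `r = Tr S`. -/
def scalarCurvature (x : M) : ℝ := metricTrace I x (ricci I x)

/-- The `*`-Ricci tensor `S*(u, v) = (1/2) Tr (w ↦ Φ (R(u, Φ v) w))`. -/
def starRicci (Φ : Π x : M, TangentSpace I x →L[ℝ] TangentSpace I x) (x : M)
    (u v : TangentSpace I x) : ℝ :=
  (1 / 2) * metricTrace I x fun e f ↦ inner ℝ (Φ x (curvatureAt I x u (Φ x v) e)) f

/-- The `*`-scalar curvature `r* = Tr S*`. -/
def starScalarCurvature (Φ : Π x : M, TangentSpace I x →L[ℝ] TangentSpace I x) (x : M) : ℝ :=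
  metricTrace I x (starRicci I Φ x)

/-- The Lie derivative of the metric:
`(L_z g)(X, Y) = z (g(X, Y)) - g([z, X], Y) - g(X, [z, Y])`. -/
def lieDerivMetric (z X Y : Π x : M, TangentSpace I x) (x : M) : ℝ :=
  mvfderiv I (fun y ↦ inner ℝ (X y) (Y y)) x (z x)
    - inner ℝ (mlieBracket I z X x) (Y x) - inner ℝ (X x) (mlieBracket I z Y x)

/-- `(Φ, ξ, η, g)` is a smooth almost contact metric structure. -/
structure IsAlmostContactMetric (Φ : Π x : M, TangentSpace I x →L[ℝ] TangentSpace I x)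
    (ξ : Π x : M, TangentSpace I x) (η : Π x : M, TangentSpace I x →L[ℝ] ℝ) : Prop where
  smooth_Φ : ContMDiff I (I.prod 𝓘(ℝ, E →L[ℝ] E)) ∞
    (fun x ↦ (TotalSpace.mk' (E →L[ℝ] E) x (Φ x) :
      TotalSpace (E →L[ℝ] E) (fun x : M ↦ TangentSpace I x →L[ℝ] TangentSpace I x)))
  smooth_ξ : ContMDiff I (I.prod 𝓘(ℝ, E)) ∞ (T% ξ)
  smooth_η : ContMDiff I (I.prod 𝓘(ℝ, E →L[ℝ] ℝ)) ∞
    (fun x ↦ (TotalSpace.mk' (E →L[ℝ] ℝ) x (η x) :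
      TotalSpace (E →L[ℝ] ℝ) (fun x : M ↦ TangentSpace I x →L[ℝ] Bundle.Trivial M ℝ x)))
  Φ_Φ : ∀ (x : M) (v : TangentSpace I x), Φ x (Φ x v) = -v + η x v • ξ x
  η_Φ : ∀ (x : M) (v : TangentSpace I x), η x (Φ x v) = 0
  Φ_ξ : ∀ x : M, Φ x (ξ x) = 0
  η_ξ : ∀ x : M, η x (ξ x) = 1
  inner_Φ_Φ : ∀ (x : M) (v w : TangentSpace I x),
    inner ℝ (Φ x v) (Φ x w) = inner ℝ v w - η x v * η x w
  inner_Φ : ∀ (x : M) (v w : TangentSpace I x), inner ℝ v (Φ x w) = -inner ℝ (Φ x v) w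
  inner_ξ : ∀ (x : M) (v : TangentSpace I x), inner ℝ v (ξ x) = η x v

/-- `(Φ, ξ, η, g)` is a Kenmotsu structure: an almost contact metric structure with
`(∇_v Φ)Y = -g(v, ΦY) ξ - η(Y) Φv` and `∇_v ξ = v - η(v) ξ`, where
`(∇_v Φ)Y = ∇_v (ΦY) - Φ(∇_v Y)`. The first identity is tensorial in `Y`; it is required at `x` for
the vector fields `Y` differentiable at `x`. -/
structure IsKenmotsu (Φ : Π x : M, TangentSpace I x →L[ℝ] TangentSpace I x)
    (ξ : Π x : M, TangentSpace I x) (η : Π x : M, TangentSpace I x →L[ℝ] ℝ) : Prop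
    extends IsAlmostContactMetric I Φ ξ η where
  cov_Φ : ∀ (x : M) (v : TangentSpace I x) (Y : Π x : M, TangentSpace I x), MDiffAt (T% Y) x →
    leviCivita I (fun y ↦ Φ y (Y y)) x v - Φ x (leviCivita I Y x v) =
      -inner ℝ v (Φ x (Y x)) • ξ x - η x (Y x) • Φ x v
  cov_ξ : ∀ (x : M) (v : TangentSpace I x), leviCivita I ξ x v = v - η x v • ξ x

/-- `(g, z, Ω, ω₀)` is a `*`-Ricci-Bourguignon soliton: `L_z g + 2 S* = 2 (Ω + ω₀ r*) g` with `z` a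
smooth vector field and `Ω, ω₀` real constants. -/
structure IsStarRicciBourguignonSoliton
    (Φ : Π x : M, TangentSpace I x →L[ℝ] TangentSpace I x)
    (z : Π x : M, TangentSpace I x) (Ω ω₀ : ℝ) : Prop where
  smooth : ContMDiff I (I.prod 𝓘(ℝ, E)) ∞ (T% z)
  soliton_eq : ∀ (x : M) (X Y : Π x : M, TangentSpace I x),
    MDiffAt (T% X) x → MDiffAt (T% Y) x →
    lieDerivMetric I z X Y x + 2 * starRicci I Φ x (X x) (Y x) =
      2 * (Ω + ω₀ * starScalarCurvature I Φ x) * inner ℝ (X x) (Y x)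

/-- `(g, z, Λ, μ, ω₀)` is an `η`-Ricci-Bourguignon soliton:
`L_z g + 2 S = 2 Λ g + 2 ω₀ r g + 2 μ η ⊗ η` with `z` a smooth vector field and `Λ, μ, ω₀` real
constants. -/
structure IsEtaRicciBourguignonSoliton (η : Π x : M, TangentSpace I x →L[ℝ] ℝ)
    (z : Π x : M, TangentSpace I x) (Λ μ ω₀ : ℝ) : Prop where
  smooth : ContMDiff I (I.prod 𝓘(ℝ, E)) ∞ (T% z)
  soliton_eq : ∀ (x : M) (X Y : Π x : M, TangentSpace I x),
    MDiffAt (T% X) x → MDiffAt (T% Y) x →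
    lieDerivMetric I z X Y x + 2 * ricci I x (X x) (Y x) =
      2 * Λ * inner ℝ (X x) (Y x) + 2 * ω₀ * scalarCurvature I x * inner ℝ (X x) (Y x)
        + 2 * μ * (η x (X x) * η x (Y x))

end

end KenmotsuGeometry

namespace KenmotsuGeometry

section Smoothness

variable {E : Type*} [NormedAddCommGroup E] [NormedSpace ℝ E]
  {H : Type*} [TopologicalSpace H] {I : ModelWithCorners ℝ E H}
  {M : Type*} [TopologicalSpace M] [ChartedSpace H M]

theorem contMDiffAt_det {ι : Type*} [Fintype ι] [DecidableEq ι] {n : ℕ∞ω}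
    {A : M → Matrix ι ι ℝ} {x : M}
    (hA : ∀ i j, CMDiffAt n (fun y ↦ A y i j) x) : CMDiffAt n (fun y ↦ (A y).det) x := by
  simp only [Matrix.det_apply']
  exact ContMDiffAt.sum fun σ _ ↦ contMDiffAt_const.mul (ContMDiffAt.prod fun i _ ↦ hA _ _)

variable [IsManifold I ∞ M]

/-- The derivative of a `C^(m+1)` function along a `C^m` vector field is `C^m`. -/
theorem contMDiffAt_mvfderiv_apply {m n : ℕ∞ω} {f : M → ℝ} {X : Π x : M, TangentSpace I x} {x : M}
    (hf : CMDiffAt n f x) (hX : CMDiffAt m (T% X) x) (hmn : m + 1 ≤ n) :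
    CMDiffAt m (fun y ↦ mvfderiv I f y (X y)) x := by
  have h := ContMDiffAt.clm_apply_of_inCoordinates (F₁ := E) (F₂ := ℝ)
    (E₁ := fun x : M ↦ TangentSpace I x) (E₂ := fun t : ℝ ↦ TangentSpace 𝓘(ℝ, ℝ) t)
    (hf.mfderiv_const hmn) hX (hf.of_le (le_self_add.trans hmn))
  have h2 := (contMDiffAt_totalSpace.1 h).2
  simp at h2
  exact h2

variable [RiemannianBundle (fun x : M ↦ TangentSpace I x)]
  [IsContMDiffRiemannianBundle I ∞ E (fun x : M ↦ TangentSpace I x)]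

theorem contMDiffAt_inner {n : ℕ∞ω} (hn : n ≤ ∞) {X Y : Π x : M, TangentSpace I x} {x : M}
    (hX : CMDiffAt n (T% X) x) (hY : CMDiffAt n (T% Y) x) :
    CMDiffAt n (fun y ↦ inner ℝ (X y) (Y y)) x := by
  have : IsContMDiffRiemannianBundle I n E (fun x : M ↦ TangentSpace I x) := .of_le hn
  exact ContMDiffAt.inner_bundle (E := fun x : M ↦ TangentSpace I x) hX hY

/-- A vector field is `C^n` if its inner products with all `C^n` vector fields are. -/
theorem contMDiffAt_of_inner [FiniteDimensional ℝ E] {n : ℕ∞ω} (hn : n ≤ ∞)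
    {V : Π x : M, TangentSpace I x} {x : M}
    (h : ∀ W : Π x : M, TangentSpace I x, CMDiffAt ∞ (T% W) x →
      CMDiffAt n (fun y ↦ inner ℝ (V y) (W y)) x) : CMDiffAt n (T% V) x := by
  classical
  let e := trivializationAt E (fun x : M ↦ TangentSpace I x) x
  let b := Module.finBasis ℝ E
  have hx : x ∈ e.baseSet := FiberBundle.mem_baseSet_trivializationAt' x
  have hs' : IsLocalFrameOn I E ∞ (e.localFrame b) e.baseSet :=
    e.isLocalFrameOn_localFrame_baseSet I ∞ b
  have hs : ∀ i, CMDiffAt ∞ (T% (e.localFrame b i)) x := fun i ↦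
    hs'.contMDiffAt e.open_baseSet hx i
  have hsn : IsLocalFrameOn I E n (e.localFrame b) e.baseSet :=
    ⟨hs'.linearIndependent, hs'.generating, fun i ↦ (hs'.contMDiffOn i).of_le hn⟩
  refine hsn.contMDiffAt_of_coeff (fun i ↦ ?_) (e.open_baseSet.mem_nhds hx)
  let G : M → Matrix _ _ ℝ := fun y ↦ Matrix.gram ℝ (fun i ↦ e.localFrame b i y)
  have hdet : ∀ y ∈ e.baseSet, (G y).det ≠ 0 := fun y hy ↦
    Matrix.det_gram_ne_zero_iff_linearIndependent.2 (hs'.linearIndependent hy)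
  have hG : ∀ i j, CMDiffAt n (fun y ↦ G y i j) x := fun i j ↦
    contMDiffAt_inner hn ((hs i).of_le hn) ((hs j).of_le hn)
  have key : ∀ y ∈ e.baseSet, hsn.coeff i y (V y) =
      ((G y).updateCol i (fun j ↦ inner ℝ (V y) (e.localFrame b j y))).det * ((G y).det)⁻¹ := by
    intro y hy
    rw [eq_mul_inv_iff_mul_eq₀ (hdet y hy), ← Matrix.cramer_apply,
      ← Matrix.det_smul_inv_mulVec_eq_cramer _ _ (isUnit_iff_ne_zero.2 (hdet y hy))]
    have : (fun j ↦ inner ℝ (V y) (e.localFrame b j y)) =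
        (G y).mulVec (fun k ↦ hsn.coeff k y (V y)) := by
      ext j
      conv_lhs => rw [hsn.coeff_sum_eq V hy]
      simp [Matrix.mulVec, dotProduct, G, sum_inner, real_inner_smul_right, Matrix.gram_apply,
        real_inner_comm, mul_comm]
    rw [this]
    simp [Matrix.mulVec_mulVec, Matrix.nonsing_inv_mul _ (isUnit_iff_ne_zero.2 (hdet y hy)),
      mul_comm]
  have hq : CMDiffAt n (fun y ↦
      ((G y).updateCol i (fun j ↦ inner ℝ (V y) (e.localFrame b j y))).det * ((G y).det)⁻¹) x := by
    refine (contMDiffAt_det fun j k ↦ ?_).mul ((contMDiffAt_det hG).inv₀ (hdet x hx))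
    simp only [Matrix.updateCol_apply]
    split_ifs
    · exact h _ (hs j)
    · exact hG j k
  refine hq.congr_of_eventuallyEq ?_
  filter_upwards [e.open_baseSet.mem_nhds hx] with y hy
  exact key y hy

end Smoothness

section LeviCivita

variable {E : Type*} [NormedAddCommGroup E] [NormedSpace ℝ E]
  {H : Type*} [TopologicalSpace H] {I : ModelWithCorners ℝ E H}
  {M : Type*} [TopologicalSpace M] [ChartedSpace H M] [IsManifold I ∞ M]

theorem mdifferentiableAt_of_contMDiffAt_top {X : Π x : M, TangentSpace I x} {x : M}
    (hX : CMDiffAt ∞ (T% X) x) : MDiffAt (T% X) x := hX.mdifferentiableAt (by simp)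

theorem eventually_mdifferentiableAt {X : Π x : M, TangentSpace I x} {x : M}
    (hX : CMDiffAt ∞ (T% X) x) : ∀ᶠ y in 𝓝 x, MDiffAt (T% X) y := by
  filter_upwards [(contMDiffAt_iff_contMDiffAt_nhds (by simp)).1 (hX.of_le (by simp : 1 ≤ ∞))]
    with y hy
  exact hy.mdifferentiableAt (by simp)

theorem eventually_mdifferentiableAt_fun {f : M → ℝ} {x : M}
    (hf : CMDiffAt ∞ f x) : ∀ᶠ y in 𝓝 x, MDiffAt f y := by
  filter_upwards [(contMDiffAt_iff_contMDiffAt_nhds (by simp)).1 (hf.of_le (by simp : 1 ≤ ∞))]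
    with y hy
  exact hy.mdifferentiableAt (by simp)

omit [IsManifold I ∞ M] in
theorem mvfderiv_congr {f g : M → ℝ} {x : M} (h : f =ᶠ[𝓝 x] g) :
    mvfderiv I f x = mvfderiv I g x := by
  ext v
  simp only [mvfderiv, ContinuousLinearMap.comp_apply, h.mfderiv_eq]
  rfl

theorem contMDiffAt_mvfderiv_top {f : M → ℝ} {X : Π x : M, TangentSpace I x} {x : M}
    (hf : CMDiffAt ∞ f x) (hX : CMDiffAt ∞ (T% X) x) :
    CMDiffAt ∞ (fun y ↦ mvfderiv I f y (X y)) x :=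
  contMDiffAt_mvfderiv_apply hf hX (by simp)

variable [FiniteDimensional ℝ E]

theorem contMDiffAt_mlieBracket {X Y : Π x : M, TangentSpace I x} {x : M}
    (hX : CMDiffAt ∞ (T% X) x) (hY : CMDiffAt ∞ (T% Y) x) :
    CMDiffAt ∞ (T% (mlieBracket I X Y)) x := by
  have : IsManifold I (((⊤ : ℕ∞) : ℕ∞ω) + 1) M := inferInstanceAs (IsManifold I ∞ M)
  have : IsManifold I (minSmoothness ℝ 2) M := by
    rw [minSmoothness_of_isRCLikeNormedField]; infer_instance
  exact ContMDiffAt.mlieBracket_vectorField (m := ⊤) (n := ⊤) hX hY (by simp)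

theorem mlieBracket_jacobi {X Y Z : Π x : M, TangentSpace I x} {x : M}
    (hX : CMDiffAt ∞ (T% X) x) (hY : CMDiffAt ∞ (T% Y) x) (hZ : CMDiffAt ∞ (T% Z) x) :
    mlieBracket I X (mlieBracket I Y Z) x =
      mlieBracket I (mlieBracket I X Y) Z x + mlieBracket I Y (mlieBracket I X Z) x := by
  have : IsManifold I (minSmoothness ℝ 3) M := by
    rw [minSmoothness_of_isRCLikeNormedField]; infer_instance
  have h : minSmoothness ℝ 2 ≤ ∞ := by
    rw [minSmoothness_of_isRCLikeNormedField]; exact WithTop.coe_le_coe.2 le_top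
  exact leibniz_identity_mlieBracket_apply (hX.of_le h) (hY.of_le h) (hZ.of_le h)

/-- The Lie bracket of vector fields is their commutator as derivations. -/
theorem mvfderiv_mlieBracket {f : M → ℝ} {X Y : Π x : M, TangentSpace I x} {x : M}
    (hf : CMDiffAt ∞ f x) (hX : CMDiffAt ∞ (T% X) x) (hY : CMDiffAt ∞ (T% Y) x) :
    mvfderiv I f x (mlieBracket I X Y x) =
      mvfderiv I (fun y ↦ mvfderiv I f y (Y y)) x (X x)
        - mvfderiv I (fun y ↦ mvfderiv I f y (X y)) x (Y x) := by
  by_cases hw : ∃ w : TangentSpace I x, w ≠ 0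
  · obtain ⟨w, hw⟩ := hw
    let W := extend E w
    have hW : CMDiffAt ∞ (T% W) x := contMDiffAt_extend I E w
    have hfW : CMDiffAt ∞ (T% (f • W)) x := hf.smul_section hW
    have hJ := mlieBracket_jacobi hX hY hW
    have hJf := mlieBracket_jacobi hX hY hfW
    have expand : ∀ {V : Π x : M, TangentSpace I x} {Z : Π x : M, TangentSpace I x},
        CMDiffAt ∞ (T% V) x → CMDiffAt ∞ (T% Z) x →
        mlieBracket I V (mlieBracket I Z (f • W)) x =
          mvfderiv I (fun y ↦ mvfderiv I f y (Z y)) x (V x) • W x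
            + mvfderiv I f x (Z x) • mlieBracket I V W x
            + (mvfderiv I f x (V x) • mlieBracket I Z W x
              + f x • mlieBracket I V (mlieBracket I Z W) x) := by
      intro V Z hV hZ
      have h1 : mlieBracket I Z (f • W) =ᶠ[𝓝 x]
          (fun y ↦ mvfderiv I f y (Z y)) • W + f • mlieBracket I Z W := by
        filter_upwards [eventually_mdifferentiableAt_fun hf, eventually_mdifferentiableAt hW]
          with y hy hy'
        exact mlieBracket_smul_right hy hy'
      have hZf := contMDiffAt_mvfderiv_top hf hZ
      have hZW := contMDiffAt_mlieBracket hZ hW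
      have h2 : mlieBracket I V (mlieBracket I Z (f • W)) x = mlieBracket I V
          ((fun y ↦ mvfderiv I f y (Z y)) • W + f • mlieBracket I Z W) x :=
        Filter.EventuallyEq.mlieBracket_vectorField_eq (.refl _ _) h1
      rw [h2,
        mlieBracket_add_right
          (mdifferentiableAt_of_contMDiffAt_top (hZf.smul_section hW))
          (mdifferentiableAt_of_contMDiffAt_top (hf.smul_section hZW)),
        mlieBracket_smul_right (hZf.mdifferentiableAt (by simp))
          (mdifferentiableAt_of_contMDiffAt_top hW),
        mlieBracket_smul_right (hf.mdifferentiableAt (by simp))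
          (mdifferentiableAt_of_contMDiffAt_top hZW)]
    rw [expand hX hY, expand hY hX, mlieBracket_smul_right (hf.mdifferentiableAt (by simp))
      (mdifferentiableAt_of_contMDiffAt_top hW), hJ] at hJf
    have h0 : (mvfderiv I f x (mlieBracket I X Y x) -
        (mvfderiv I (fun y ↦ mvfderiv I f y (Y y)) x (X x)
        - mvfderiv I (fun y ↦ mvfderiv I f y (X y)) x (Y x))) • W x = 0 := by
      rw [← sub_eq_zero] at hJf
      rw [← neg_eq_zero, ← hJf]
      module
    rw [smul_eq_zero] at h0
    have hWx : W x = w := extend_apply_self E w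
    exact sub_eq_zero.1 (h0.resolve_right (hWx ▸ hw))
  · push Not at hw
    simp [hw (X x), hw (Y x), hw (mlieBracket I X Y x)]

variable [RiemannianBundle (fun x : M ↦ TangentSpace I x)]
  [IsContMDiffRiemannianBundle I ∞ E (fun x : M ↦ TangentSpace I x)]

theorem contMDiffAt_leviCivita {Z X : Π x : M, TangentSpace I x} {x : M}
    (hZ : CMDiffAt ∞ (T% Z) x) (hX : CMDiffAt ∞ (T% X) x) :
    CMDiffAt ∞ (T% (fun y ↦ leviCivita I Z y (X y))) x := by
  refine contMDiffAt_of_inner le_rfl fun W hW ↦ ?_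
  have hk : CMDiffAt ∞ (koszul I Z X W) x :=
    (((((contMDiffAt_mvfderiv_top (contMDiffAt_inner le_rfl hZ hW) hX).add
      (contMDiffAt_mvfderiv_top (contMDiffAt_inner le_rfl hW hX) hZ)).sub
      (contMDiffAt_mvfderiv_top (contMDiffAt_inner le_rfl hX hZ) hW)).sub
      (contMDiffAt_inner le_rfl hX (contMDiffAt_mlieBracket hZ hW))).sub
      (contMDiffAt_inner le_rfl hZ (contMDiffAt_mlieBracket hX hW))).add
      (contMDiffAt_inner le_rfl hW (contMDiffAt_mlieBracket hX hZ))
  have hk2 : CMDiffAt ∞ (fun y ↦ (1 / 2 : ℝ) * koszul I Z X W y) x := contMDiffAt_const.mul hk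
  refine hk2.congr_of_eventuallyEq ?_
  filter_upwards [eventually_mdifferentiableAt hZ, eventually_mdifferentiableAt hX,
    eventually_mdifferentiableAt hW] with y h1 h2 h3
  rw [← inner_leviCivitaFun I h1 h2 h3]
  change inner ℝ (leviCivitaFun I Z y (X y)) (W y) = _
  ring

theorem leviCivita_congr {Z Z' : Π x : M, TangentSpace I x} {x : M} (hZ : MDiffAt (T% Z) x)
    (hZ' : MDiffAt (T% Z') x) (h : ∀ᶠ y in 𝓝 x, Z y = Z' y) :
    leviCivita I Z x = leviCivita I Z' x :=
  (leviCivitaFun_isCov I).congr_of_eventuallyEq hZ hZ' Filter.univ_mem h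

theorem leviCivita_add {Z Z' : Π x : M, TangentSpace I x} {x : M} (hZ : MDiffAt (T% Z) x)
    (hZ' : MDiffAt (T% Z') x) :
    leviCivita I (fun y ↦ Z y + Z' y) x = leviCivita I Z x + leviCivita I Z' x :=
  (leviCivitaFun_isCov I).add hZ hZ'

theorem leviCivita_const_smul {Z : Π x : M, TangentSpace I x} {x : M} (c : ℝ)
    (hZ : MDiffAt (T% Z) x) :
    leviCivita I (fun y ↦ c • Z y) x = c • leviCivita I Z x :=
  (leviCivitaFun_isCov I).smul_const c hZ

theorem leviCivita_smul {f : M → ℝ} {Z : Π x : M, TangentSpace I x} {x : M}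
    (hf : MDiffAt f x) (hZ : MDiffAt (T% Z) x) (v : TangentSpace I x) :
    leviCivita I (fun y ↦ f y • Z y) x v = f x • leviCivita I Z x v + mvfderiv I f x v • Z x := by
  have h := congr($((leviCivitaFun_isCov I).leibniz hZ hf) v)
  exact h

theorem leviCivita_sub {Z Z' : Π x : M, TangentSpace I x} {x : M} (hZ : MDiffAt (T% Z) x)
    (hZ' : MDiffAt (T% Z') x) :
    leviCivita I (fun y ↦ Z y - Z' y) x = leviCivita I Z x - leviCivita I Z' x := by
  have h : MDiffAt (T% (fun y ↦ (-1 : ℝ) • Z' y)) x :=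
    mdifferentiableAt_const.smul_section hZ'
  have h2 := leviCivita_add hZ h
  rw [leviCivita_const_smul (-1) hZ'] at h2
  simpa [sub_eq_add_neg] using h2

theorem leviCivita_sub_eq_mlieBracket {X Y : Π x : M, TangentSpace I x} {x : M}
    (hX : MDiffAt (T% X) x) (hY : MDiffAt (T% Y) x) :
    leviCivita I Y x (X x) - leviCivita I X x (Y x) = mlieBracket I X Y x :=
  (leviCivita I (M := M)).torsion_eq_zero_iff.1 (leviCivita_torsion I) hX hY

end LeviCivita

section Curvature

variable {E : Type*} [NormedAddCommGroup E] [NormedSpace ℝ E] [FiniteDimensional ℝ E]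
  {H : Type*} [TopologicalSpace H] {I : ModelWithCorners ℝ E H}
  {M : Type*} [TopologicalSpace M] [ChartedSpace H M] [IsManifold I ∞ M]
  [RiemannianBundle (fun x : M ↦ TangentSpace I x)]
  [IsContMDiffRiemannianBundle I ∞ E (fun x : M ↦ TangentSpace I x)]

theorem curvature_swap (X Y Z : Π x : M, TangentSpace I x) (x : M) :
    curvature I X Y Z x = -curvature I Y X Z x := by
  simp only [curvature, mlieBracket_swap_apply (V := X) (W := Y), map_neg]
  abel

theorem eventually_mvfderiv_inner {X Y Z : Π x : M, TangentSpace I x} {x : M}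
    (hX : CMDiffAt ∞ (T% X) x) (hY : CMDiffAt ∞ (T% Y) x) (hZ : CMDiffAt ∞ (T% Z) x) :
    (fun y ↦ mvfderiv I (fun y ↦ inner ℝ (Y y) (Z y)) y (X y)) =ᶠ[𝓝 x] fun y ↦
      inner ℝ (leviCivita I Y y (X y)) (Z y) + inner ℝ (Y y) (leviCivita I Z y (X y)) := by
  filter_upwards [eventually_mdifferentiableAt hX, eventually_mdifferentiableAt hY,
    eventually_mdifferentiableAt hZ] with y h1 h2 h3
  exact leviCivita_metric I h1 h2 h3

theorem mvfderiv_mvfderiv_inner {X Y Z W : Π x : M, TangentSpace I x} {x : M}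
    (hX : CMDiffAt ∞ (T% X) x) (hY : CMDiffAt ∞ (T% Y) x) (hZ : CMDiffAt ∞ (T% Z) x)
    (hW : CMDiffAt ∞ (T% W) x) :
    mvfderiv I (fun y ↦ mvfderiv I (fun y ↦ inner ℝ (Z y) (W y)) y (Y y)) x (X x) =
      inner ℝ (leviCivita I (fun y ↦ leviCivita I Z y (Y y)) x (X x)) (W x)
        + inner ℝ (leviCivita I Z x (Y x)) (leviCivita I W x (X x))
        + inner ℝ (leviCivita I Z x (X x)) (leviCivita I W x (Y x))
        + inner ℝ (Z x) (leviCivita I (fun y ↦ leviCivita I W y (Y y)) x (X x)) := by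
  have hZY := contMDiffAt_leviCivita hZ hY
  have hWY := contMDiffAt_leviCivita hW hY
  rw [mvfderiv_congr (eventually_mvfderiv_inner hY hZ hW),
    mvfderiv_fun_add ((contMDiffAt_inner le_rfl hZY hW).mdifferentiableAt (by simp))
      ((contMDiffAt_inner le_rfl hZ hWY).mdifferentiableAt (by simp)), add_apply,
    leviCivita_metric I (mdifferentiableAt_of_contMDiffAt_top hX)
      (mdifferentiableAt_of_contMDiffAt_top hZY) (mdifferentiableAt_of_contMDiffAt_top hW),
    leviCivita_metric I (mdifferentiableAt_of_contMDiffAt_top hX)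
      (mdifferentiableAt_of_contMDiffAt_top hZ) (mdifferentiableAt_of_contMDiffAt_top hWY)]
  ring

theorem inner_curvature_skew {X Y Z W : Π x : M, TangentSpace I x} {x : M}
    (hX : CMDiffAt ∞ (T% X) x) (hY : CMDiffAt ∞ (T% Y) x) (hZ : CMDiffAt ∞ (T% Z) x)
    (hW : CMDiffAt ∞ (T% W) x) :
    inner ℝ (curvature I X Y Z x) (W x) = -inner ℝ (Z x) (curvature I X Y W x) := by
  have h := mvfderiv_mlieBracket (contMDiffAt_inner le_rfl hZ hW) hX hY
  rw [mvfderiv_mvfderiv_inner hX hY hZ hW, mvfderiv_mvfderiv_inner hY hX hZ hW,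
    leviCivita_metric I (mdifferentiableAt_of_contMDiffAt_top (contMDiffAt_mlieBracket hX hY))
      (mdifferentiableAt_of_contMDiffAt_top hZ) (mdifferentiableAt_of_contMDiffAt_top hW)] at h
  simp only [curvature, inner_sub_left, inner_sub_right]
  linarith

theorem leviCivita_mlieBracket {X Y Z : Π x : M, TangentSpace I x} {x : M}
    (hX : CMDiffAt ∞ (T% X) x) (hY : CMDiffAt ∞ (T% Y) x) (hZ : CMDiffAt ∞ (T% Z) x) :
    mlieBracket I X (mlieBracket I Y Z) x =
      leviCivita I (fun y ↦ leviCivita I Z y (Y y)) x (X x)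
        - leviCivita I (fun y ↦ leviCivita I Y y (Z y)) x (X x)
        - leviCivita I X x (mlieBracket I Y Z x) := by
  have hZY := mdifferentiableAt_of_contMDiffAt_top (contMDiffAt_leviCivita hZ hY)
  have hYZ := mdifferentiableAt_of_contMDiffAt_top (contMDiffAt_leviCivita hY hZ)
  have hB := mdifferentiableAt_of_contMDiffAt_top (contMDiffAt_mlieBracket hY hZ)
  rw [← leviCivita_sub_eq_mlieBracket (mdifferentiableAt_of_contMDiffAt_top hX) hB,
    ← sub_apply, ← leviCivita_sub hZY hYZ]
  congr 2
  refine leviCivita_congr hB (mdifferentiableAt_sub_section hZY hYZ) ?_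
  filter_upwards [eventually_mdifferentiableAt hY, eventually_mdifferentiableAt hZ] with y h1 h2
  exact (leviCivita_sub_eq_mlieBracket h1 h2).symm

theorem curvature_bianchi {X Y Z : Π x : M, TangentSpace I x} {x : M}
    (hX : CMDiffAt ∞ (T% X) x) (hY : CMDiffAt ∞ (T% Y) x) (hZ : CMDiffAt ∞ (T% Z) x) :
    curvature I X Y Z x + curvature I Y Z X x + curvature I Z X Y x = 0 := by
  have hJ := mlieBracket_jacobi hX hY hZ
  have h1 := leviCivita_mlieBracket hX hY hZ
  have h2 := leviCivita_mlieBracket hY hX hZ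
  have h3 := leviCivita_mlieBracket hZ hX hY
  rw [mlieBracket_swap_apply (V := mlieBracket I X Y), h1, h2, h3] at hJ
  simp only [curvature]
  rw [mlieBracket_swap_apply (V := Z) (W := X), map_neg]
  rw [← sub_eq_zero] at hJ
  rw [← hJ]
  abel

theorem curvatureAt_swap (x : M) (u v w : TangentSpace I x) :
    curvatureAt I x u v w = -curvatureAt I x v u w :=
  curvature_swap _ _ _ _

theorem curvatureAt_bianchi (x : M) (u v w : TangentSpace I x) :
    curvatureAt I x u v w + curvatureAt I x v w u + curvatureAt I x w u v = 0 :=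
  curvature_bianchi (contMDiffAt_extend I E u) (contMDiffAt_extend I E v)
    (contMDiffAt_extend I E w)

theorem inner_curvatureAt_skew (x : M) (u v w t : TangentSpace I x) :
    inner ℝ (curvatureAt I x u v w) t = -inner ℝ (curvatureAt I x u v t) w := by
  have h := inner_curvature_skew (contMDiffAt_extend I E u) (contMDiffAt_extend I E v)
    (contMDiffAt_extend I E w) (contMDiffAt_extend I E t)
  rw [extend_apply_self, extend_apply_self, real_inner_comm] at h
  rw [real_inner_comm, real_inner_comm w]
  exact h

theorem curvature_extend_eq_curvatureAt {x : M} (u v : TangentSpace I x)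
    {Z : Π x : M, TangentSpace I x} (hZ : CMDiffAt ∞ (T% Z) x) :
    curvature I (extend E u) (extend E v) Z x = curvatureAt I x u v (Z x) := by
  apply ext_inner_right ℝ
  intro t
  have h := inner_curvature_skew (contMDiffAt_extend I E u) (contMDiffAt_extend I E v) hZ
    (contMDiffAt_extend I E t)
  rw [inner_curvatureAt_skew, real_inner_comm (Z x)]
  rw [extend_apply_self] at h
  exact h

section Extend

omit [FiniteDimensional ℝ E] [RiemannianBundle (fun x : M ↦ TangentSpace I x)]
  [IsContMDiffRiemannianBundle I ∞ E (fun x : M ↦ TangentSpace I x)]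

theorem eventually_extend_eq_symmL {x : M} (u : TangentSpace I x) : ∀ᶠ y in 𝓝 x,
    extend E u y = (trivializationAt E (fun x : M ↦ TangentSpace I x) x).symmL ℝ y
      ((trivializationAt E (fun x : M ↦ TangentSpace I x) x).continuousLinearMapAt ℝ x u) := by
  let t := trivializationAt E (fun x : M ↦ TangentSpace I x) x
  have hx : x ∈ t.baseSet := FiberBundle.mem_baseSet_trivializationAt' x
  filter_upwards [t.open_baseSet.mem_nhds hx] with y hy
  rw [Trivialization.continuousLinearMapAt_apply_of_mem ℝ _ hx, Trivialization.symmL_apply _ hy]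
  rfl

theorem eventually_extend_add {x : M} (u v : TangentSpace I x) :
    ∀ᶠ y in 𝓝 x, extend E (u + v) y = extend E u y + extend E v y := by
  filter_upwards [eventually_extend_eq_symmL u, eventually_extend_eq_symmL v,
    eventually_extend_eq_symmL (u + v)] with y hu hv huv
  rw [hu, hv, huv, map_add, map_add]

theorem eventually_extend_smul {x : M} (c : ℝ) (u : TangentSpace I x) :
    ∀ᶠ y in 𝓝 x, extend E (c • u) y = c • extend E u y := by
  filter_upwards [eventually_extend_eq_symmL u, eventually_extend_eq_symmL (c • u)] with y hu hcu
  rw [hu, hcu, map_smul, map_smul]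

end Extend

theorem curvature_congr_left {X X' Z : Π x : M, TangentSpace I x} {x : M} (h : X =ᶠ[𝓝 x] X')
    (hX : CMDiffAt ∞ (T% X) x) (hX' : CMDiffAt ∞ (T% X') x) (hZ : CMDiffAt ∞ (T% Z) x)
    (Y : Π x : M, TangentSpace I x) : curvature I X Y Z x = curvature I X' Y Z x := by
  have h1 : leviCivita I (fun y ↦ leviCivita I Z y (X y)) x
      = leviCivita I (fun y ↦ leviCivita I Z y (X' y)) x := by
    refine leviCivita_congr (mdifferentiableAt_of_contMDiffAt_top (contMDiffAt_leviCivita hZ hX))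
      (mdifferentiableAt_of_contMDiffAt_top (contMDiffAt_leviCivita hZ hX')) ?_
    filter_upwards [h] with y hy
    rw [hy]
  have h2 : mlieBracket I X Y x = mlieBracket I X' Y x :=
    Filter.EventuallyEq.mlieBracket_vectorField_eq h (.refl _ _)
  simp only [curvature, h1, h2, h.eq_of_nhds]

theorem curvature_add_left {X X' Z : Π x : M, TangentSpace I x} {x : M}
    (hX : CMDiffAt ∞ (T% X) x) (hX' : CMDiffAt ∞ (T% X') x) (hZ : CMDiffAt ∞ (T% Z) x)
    (Y : Π x : M, TangentSpace I x) :
    curvature I (X + X') Y Z x = curvature I X Y Z x + curvature I X' Y Z x := by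
  simp only [curvature, Pi.add_apply, map_add]
  rw [leviCivita_add (mdifferentiableAt_of_contMDiffAt_top (contMDiffAt_leviCivita hZ hX))
    (mdifferentiableAt_of_contMDiffAt_top (contMDiffAt_leviCivita hZ hX')),
    mlieBracket_add_left (mdifferentiableAt_of_contMDiffAt_top hX)
      (mdifferentiableAt_of_contMDiffAt_top hX'), map_add, add_apply]
  abel

theorem curvature_const_smul_left (c : ℝ) {X Z : Π x : M, TangentSpace I x} {x : M}
    (hX : CMDiffAt ∞ (T% X) x) (hZ : CMDiffAt ∞ (T% Z) x) (Y : Π x : M, TangentSpace I x) :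
    curvature I (c • X) Y Z x = c • curvature I X Y Z x := by
  simp only [curvature, Pi.smul_apply, map_smul]
  rw [leviCivita_const_smul _ (mdifferentiableAt_of_contMDiffAt_top (contMDiffAt_leviCivita hZ hX)),
    mlieBracket_const_smul_left (mdifferentiableAt_of_contMDiffAt_top hX), map_smul, smul_apply]
  module

theorem curvatureAt_add_left (x : M) (u u' v w : TangentSpace I x) :
    curvatureAt I x (u + u') v w = curvatureAt I x u v w + curvatureAt I x u' v w := by
  have hu := contMDiffAt_extend (k := ∞) I E u
  have hu' := contMDiffAt_extend (k := ∞) I E u'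
  have hw := contMDiffAt_extend (k := ∞) I E w
  have hs : CMDiffAt ∞ (T% (extend E u + extend E u')) x := hu.add_section hu'
  exact (curvature_congr_left (eventually_extend_add u u') (contMDiffAt_extend I E _)
    hs hw _).trans (curvature_add_left hu hu' hw _)

theorem curvatureAt_smul_left (x : M) (c : ℝ) (u v w : TangentSpace I x) :
    curvatureAt I x (c • u) v w = c • curvatureAt I x u v w := by
  have hu := contMDiffAt_extend (k := ∞) I E u
  have hw := contMDiffAt_extend (k := ∞) I E w
  have hs : CMDiffAt ∞ (T% (c • extend E u)) x := hu.const_smul_section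
  exact (curvature_congr_left (eventually_extend_smul c u) (contMDiffAt_extend I E _)
    hs hw _).trans (curvature_const_smul_left c hu hw _)

end Curvature

section Algebraic

variable {V ι : Type*} [NormedAddCommGroup V] [InnerProductSpace ℝ V] [Fintype ι]

/-- Pair symmetry of an algebraic curvature tensor. -/
theorem inner_pair_symm_of_bianchi {R : V → V → V → V}
    (swap : ∀ u v w, R u v w = -R v u w)
    (skew : ∀ u v w t, inner ℝ (R u v w) t = -inner ℝ (R u v t) w)
    (bianchi : ∀ u v w, R u v w + R v w u + R w u v = 0) (u v w t : V) :
    inner ℝ (R u v w) t = inner ℝ (R w t u) v := by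
  have B : ∀ a b c d, inner ℝ (R a b c) d + inner ℝ (R b c a) d + inner ℝ (R c a b) d = 0 :=
    fun a b c d ↦ by rw [← inner_add_left, ← inner_add_left, bianchi, inner_zero_left]
  have S : ∀ a b c d, inner ℝ (R a b c) d = -inner ℝ (R b a c) d :=
    fun a b c d ↦ by rw [swap, inner_neg_left]
  linarith [B u v w t, B v w t u, B w t u v, B t u v w, skew u v w t, skew w t u v, skew v w u t,
    skew w u v t, skew t v w u, skew t u v w, S u w t v, S v t u w]

theorem sum_apply_skew_eq (e : OrthonormalBasis ι ℝ V) (B : V →ₗ[ℝ] V →ₗ[ℝ] ℝ) {Φ : V →ₗ[ℝ] V}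
    (hΦ : ∀ v w, inner ℝ v (Φ w) = -inner ℝ (Φ v) w) :
    ∑ i, B (e i) (Φ (e i)) = -∑ i, B (Φ (e i)) (e i) := by
  have h1 : ∀ i, B (e i) (Φ (e i)) = ∑ j, inner ℝ (e j) (Φ (e i)) * B (e i) (e j) := fun i ↦ by
    conv_lhs => rw [← e.sum_repr' (Φ (e i))]
    simp
  have h2 : ∀ i, B (Φ (e i)) (e i) = ∑ j, inner ℝ (e j) (Φ (e i)) * B (e j) (e i) := fun i ↦ by
    conv_lhs => rw [← e.sum_repr' (Φ (e i))]
    simp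
  simp only [h1, h2]
  rw [Finset.sum_comm, ← Finset.sum_neg_distrib]
  refine Finset.sum_congr rfl fun i _ ↦ ?_
  rw [← Finset.sum_neg_distrib]
  refine Finset.sum_congr rfl fun j _ ↦ ?_
  rw [hΦ, real_inner_comm]
  ring

theorem sum_inner_mul_apply (e : OrthonormalBasis ι ℝ V) (L : V →ₗ[ℝ] ℝ) (v : V) :
    ∑ i, inner ℝ (e i) v * L (e i) = L v := by
  conv_rhs => rw [← e.sum_repr' v]
  simp

/-- The `*`-Ricci form of an algebraic curvature tensor of Kenmotsu type. -/
theorem starRicci_trace_eq (e : OrthonormalBasis ι ℝ V) {R : V → V → V → V} {Φ : V →ₗ[ℝ] V}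
    {ξ : V} {η : V →ₗ[ℝ] ℝ}
    (add_left : ∀ u u' v w, R (u + u') v w = R u v w + R u' v w)
    (smul_left : ∀ (c : ℝ) u v w, R (c • u) v w = c • R u v w)
    (swap : ∀ u v w, R u v w = -R v u w)
    (skew : ∀ u v w t, inner ℝ (R u v w) t = -inner ℝ (R u v t) w)
    (bianchi : ∀ u v w, R u v w + R v w u + R w u v = 0)
    (hΦ : ∀ v w, inner ℝ v (Φ w) = -inner ℝ (Φ v) w)
    (hΦΦ : ∀ v w, inner ℝ (Φ v) (Φ w) = inner ℝ v w - η v * η w)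
    (hξ : ∀ v, inner ℝ v ξ = η v) (hηξ : η ξ = 1)
    (R_ξ : ∀ u v, R u v ξ = η u • v - η v • u)
    (R_Φ : ∀ u v w, R u v (Φ w) = Φ (R u v w) + inner ℝ v w • Φ u - inner ℝ u w • Φ v
      + inner ℝ u (Φ w) • v - inner ℝ v (Φ w) • u) (u v : V) :
    (1 / 2) * ∑ i, inner ℝ (Φ (R u (Φ v) (e i))) (e i) =
      ∑ i, inner ℝ (R (e i) u v) (e i) + (Fintype.card ι - 2) * inner ℝ u v + η u * η v := by
  let B : V → V → V →ₗ[ℝ] V →ₗ[ℝ] ℝ := fun a w ↦ LinearMap.mk₂ ℝ (fun p q ↦ inner ℝ (R p a w) q)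
    (fun p p' q ↦ by rw [add_left, inner_add_left])
    (fun c p q ↦ by rw [smul_left, real_inner_smul_left, smul_eq_mul])
    (fun p q q' ↦ inner_add_right _ _ _)
    (fun c p q ↦ by rw [real_inner_smul_right, smul_eq_mul])
  have hB : ∀ a w p q, B a w p q = inner ℝ (R p a w) q := fun _ _ _ _ ↦ rfl
  have pair := inner_pair_symm_of_bianchi swap skew bianchi
  have h1 : ∀ p, inner ℝ (Φ (R u (Φ v) p)) p = B u (Φ v) p (Φ p) - B u (Φ v) (Φ p) p := by
    intro p
    have b := congr(inner ℝ $(bianchi u (Φ v) p) (Φ p))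
    rw [inner_add_left, inner_add_left, inner_zero_left, pair (Φ v) p u (Φ p),
      swap u (Φ p) (Φ v), inner_neg_left] at b
    rw [hB, hB]
    linarith [hΦ (R u (Φ v) p) p]
  have h2 : ∀ p, B u (Φ v) p (Φ p) = inner ℝ (R p u v) p - inner ℝ p ξ * B u v p ξ
      + inner ℝ u v * (inner ℝ p p - inner ℝ p ξ * η p)
      - (inner ℝ p v * inner ℝ u p - η u * (inner ℝ p v * η p))
      - inner ℝ p (Φ v) * inner ℝ (Φ u) p := by
    intro p
    have h0 : inner ℝ p (Φ p) = 0 := by linarith [hΦ p p, real_inner_comm p (Φ p)]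
    rw [hB, hB, R_Φ, hξ, hξ]
    simp only [inner_add_left, inner_sub_left, real_inner_smul_left, hΦΦ, h0, hΦ u p]
    ring
  have s1 : ∑ i, inner ℝ (e i) ξ * B u v (e i) ξ = -(inner ℝ u v - η u * η v) := by
    have := sum_inner_mul_apply e ((B u v).flip ξ) ξ
    simp only [LinearMap.flip_apply] at this
    rw [this, hB, skew, R_ξ, inner_sub_left, real_inner_smul_left, real_inner_smul_left, hηξ,
      real_inner_comm v ξ, hξ]
    ring
  have s2 : ∑ i, inner ℝ (e i) ξ * η (e i) = 1 := by rw [sum_inner_mul_apply, hηξ]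
  have s3 : ∑ i, inner ℝ (e i) v * η (e i) = η v := sum_inner_mul_apply e η v
  have s4 : ∀ a b : V, ∑ i, inner ℝ (e i) a * inner ℝ b (e i) = inner ℝ b a := fun a b ↦
    sum_inner_mul_apply e (innerₗ V b) a
  simp only [h1, Finset.sum_sub_distrib]
  rw [eq_neg_of_add_eq_zero_right (a := ∑ i, B u (Φ v) (Φ (e i)) (e i))
    (b := ∑ i, B u (Φ v) (e i) (Φ (e i))) (by rw [sum_apply_skew_eq e _ hΦ]; ring)]
  rw [show ∀ a : ℝ, 1 / 2 * (-a - a) = -a by intro a; ring, ← sum_apply_skew_eq e _ hΦ]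
  simp only [h2, Finset.sum_sub_distrib, Finset.sum_add_distrib, ← Finset.mul_sum, s1, s2, s3, s4,
    hΦΦ]
  simp
  ring

end Algebraic

section Kenmotsu

variable {E : Type*} [NormedAddCommGroup E] [NormedSpace ℝ E] [FiniteDimensional ℝ E]
  {H : Type*} [TopologicalSpace H] {I : ModelWithCorners ℝ E H}
  {M : Type*} [TopologicalSpace M] [ChartedSpace H M] [IsManifold I ∞ M]
  [RiemannianBundle (fun x : M ↦ TangentSpace I x)]
  [IsContMDiffRiemannianBundle I ∞ E (fun x : M ↦ TangentSpace I x)]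
  {Φ : Π x : M, TangentSpace I x →L[ℝ] TangentSpace I x}
  {ξ : Π x : M, TangentSpace I x} {η : Π x : M, TangentSpace I x →L[ℝ] ℝ}

omit [FiniteDimensional ℝ E]
  [IsContMDiffRiemannianBundle I ∞ E (fun x : M ↦ TangentSpace I x)] in
theorem IsAlmostContactMetric.contMDiffAt_Φ (h : IsAlmostContactMetric I Φ ξ η)
    {Y : Π x : M, TangentSpace I x} {x : M} (hY : CMDiffAt ∞ (T% Y) x) :
    CMDiffAt ∞ (T% (fun y ↦ Φ y (Y y))) x :=
  ContMDiffAt.clm_bundle_apply (F₁ := E) (F₂ := E) (E₁ := fun x : M ↦ TangentSpace I x)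
    (E₂ := fun x : M ↦ TangentSpace I x) h.smooth_Φ.contMDiffAt hY

omit [FiniteDimensional ℝ E] in
theorem IsAlmostContactMetric.contMDiffAt_η (h : IsAlmostContactMetric I Φ ξ η)
    {Y : Π x : M, TangentSpace I x} {x : M} (hY : CMDiffAt ∞ (T% Y) x) :
    CMDiffAt ∞ (fun y ↦ η y (Y y)) x := by
  simp only [← h.inner_ξ]
  exact contMDiffAt_inner le_rfl hY h.smooth_ξ.contMDiffAt

theorem IsKenmotsu.mvfderiv_η (h : IsKenmotsu I Φ ξ η) {X Y : Π x : M, TangentSpace I x} {x : M}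
    (hX : CMDiffAt ∞ (T% X) x) (hY : CMDiffAt ∞ (T% Y) x) :
    mvfderiv I (fun y ↦ η y (Y y)) x (X x) =
      η x (leviCivita I Y x (X x)) + inner ℝ (X x) (Y x) - η x (X x) * η x (Y x) := by
  simp only [← h.inner_ξ]
  rw [leviCivita_metric I (mdifferentiableAt_of_contMDiffAt_top hX)
    (mdifferentiableAt_of_contMDiffAt_top hY)
    (mdifferentiableAt_of_contMDiffAt_top h.smooth_ξ.contMDiffAt), h.cov_ξ, inner_sub_right,
    real_inner_smul_right, real_inner_comm (X x) (Y x)]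
  simp only [h.inner_ξ]
  ring

theorem IsKenmotsu.leviCivita_leviCivita_ξ (h : IsKenmotsu I Φ ξ η)
    {X Y : Π x : M, TangentSpace I x} {x : M}
    (hX : CMDiffAt ∞ (T% X) x) (hY : CMDiffAt ∞ (T% Y) x) :
    leviCivita I (fun y ↦ leviCivita I ξ y (Y y)) x (X x) =
      leviCivita I Y x (X x) - ((η x (leviCivita I Y x (X x)) + inner ℝ (X x) (Y x)
        - η x (X x) * η x (Y x)) • ξ x + η x (Y x) • (X x - η x (X x) • ξ x)) := by
  have hηY := h.contMDiffAt_η hY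
  have hξ := h.smooth_ξ.contMDiffAt (x := x)
  have hηξ : MDiffAt (T% (fun y ↦ η y (Y y) • ξ y)) x :=
    mdifferentiableAt_of_contMDiffAt_top (hηY.smul_section hξ)
  simp only [h.cov_ξ]
  rw [leviCivita_sub (mdifferentiableAt_of_contMDiffAt_top hY) hηξ, sub_apply,
    leviCivita_smul (hηY.mdifferentiableAt (by simp)) (mdifferentiableAt_of_contMDiffAt_top hξ),
    h.mvfderiv_η hX hY, h.cov_ξ, add_comm]

theorem IsKenmotsu.curvature_ξ (h : IsKenmotsu I Φ ξ η) {X Y : Π x : M, TangentSpace I x} {x : M}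
    (hX : CMDiffAt ∞ (T% X) x) (hY : CMDiffAt ∞ (T% Y) x) :
    curvature I X Y ξ x = η x (X x) • Y x - η x (Y x) • X x := by
  rw [curvature, h.leviCivita_leviCivita_ξ hX hY, h.leviCivita_leviCivita_ξ hY hX, h.cov_ξ,
    ← leviCivita_sub_eq_mlieBracket (mdifferentiableAt_of_contMDiffAt_top hX)
      (mdifferentiableAt_of_contMDiffAt_top hY), map_sub, real_inner_comm (X x) (Y x)]
  module

theorem IsKenmotsu.leviCivita_Φ (h : IsKenmotsu I Φ ξ η)
    {Y : Π x : M, TangentSpace I x} {x : M} (hY : MDiffAt (T% Y) x) (v : TangentSpace I x) :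
    leviCivita I (fun y ↦ Φ y (Y y)) x v = Φ x (leviCivita I Y x v)
      - (inner ℝ v (Φ x (Y x)) • ξ x + η x (Y x) • Φ x v) := by
  rw [sub_eq_iff_eq_add.1 (h.cov_Φ x v Y hY)]
  module

theorem IsKenmotsu.leviCivita_leviCivita_Φ (h : IsKenmotsu I Φ ξ η)
    {X Y Z : Π x : M, TangentSpace I x} {x : M}
    (hX : CMDiffAt ∞ (T% X) x) (hY : CMDiffAt ∞ (T% Y) x) (hZ : CMDiffAt ∞ (T% Z) x) :
    leviCivita I (fun y ↦ leviCivita I (fun y ↦ Φ y (Z y)) y (Y y)) x (X x) =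
      Φ x (leviCivita I (fun y ↦ leviCivita I Z y (Y y)) x (X x))
        - (inner ℝ (X x) (Φ x (leviCivita I Z x (Y x))) • ξ x
          + η x (leviCivita I Z x (Y x)) • Φ x (X x))
        - (inner ℝ (Y x) (Φ x (Z x)) • (X x - η x (X x) • ξ x)
          + (inner ℝ (leviCivita I Y x (X x)) (Φ x (Z x))
            + inner ℝ (Y x) (Φ x (leviCivita I Z x (X x)))
            - inner ℝ (X x) (Φ x (Z x)) * η x (Y x)
            - η x (Z x) * inner ℝ (Y x) (Φ x (X x))) • ξ x
          + (η x (Z x) • (Φ x (leviCivita I Y x (X x))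
              - (inner ℝ (X x) (Φ x (Y x)) • ξ x + η x (Y x) • Φ x (X x)))
            + (η x (leviCivita I Z x (X x)) + inner ℝ (X x) (Z x) - η x (X x) * η x (Z x))
              • Φ x (Y x))) := by
  have hξ := h.smooth_ξ.contMDiffAt (x := x)
  have hZY := contMDiffAt_leviCivita hZ hY
  have hΦZ := h.contMDiffAt_Φ hZ
  have hΦY := h.contMDiffAt_Φ hY
  have hηZ := h.contMDiffAt_η hZ
  have hg := contMDiffAt_inner le_rfl hY hΦZ
  have h1 := mdifferentiableAt_of_contMDiffAt_top (h.contMDiffAt_Φ hZY)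
  have h2 : MDiffAt (T% (fun y ↦ inner ℝ (Y y) (Φ y (Z y)) • ξ y)) x :=
    mdifferentiableAt_of_contMDiffAt_top (hg.smul_section hξ)
  have h3 : MDiffAt (T% (fun y ↦ η y (Z y) • Φ y (Y y))) x :=
    mdifferentiableAt_of_contMDiffAt_top (hηZ.smul_section hΦY)
  have h23 : MDiffAt (T% (fun y ↦ inner ℝ (Y y) (Φ y (Z y)) • ξ y + η y (Z y) • Φ y (Y y))) x :=
    mdifferentiableAt_add_section h2 h3
  have h123 : MDiffAt (T% (fun y ↦ Φ y (leviCivita I Z y (Y y))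
      - (inner ℝ (Y y) (Φ y (Z y)) • ξ y + η y (Z y) • Φ y (Y y)))) x :=
    mdifferentiableAt_sub_section h1 h23
  have e : ∀ᶠ y in 𝓝 x, leviCivita I (fun y ↦ Φ y (Z y)) y (Y y) =
      Φ y (leviCivita I Z y (Y y))
        - (inner ℝ (Y y) (Φ y (Z y)) • ξ y + η y (Z y) • Φ y (Y y)) := by
    filter_upwards [eventually_mdifferentiableAt hZ] with y hy
    exact h.leviCivita_Φ hy _
  rw [leviCivita_congr (mdifferentiableAt_of_contMDiffAt_top (contMDiffAt_leviCivita hΦZ hY))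
    h123 e, leviCivita_sub h1 h23, leviCivita_add h2 h3, sub_apply, add_apply,
    leviCivita_smul (hg.mdifferentiableAt (by simp)) (mdifferentiableAt_of_contMDiffAt_top hξ),
    leviCivita_smul (hηZ.mdifferentiableAt (by simp)) (mdifferentiableAt_of_contMDiffAt_top hΦY),
    h.leviCivita_Φ (mdifferentiableAt_of_contMDiffAt_top hZY),
    h.leviCivita_Φ (mdifferentiableAt_of_contMDiffAt_top hY), h.mvfderiv_η hX hZ,
    leviCivita_metric I (mdifferentiableAt_of_contMDiffAt_top hX)
      (mdifferentiableAt_of_contMDiffAt_top hY) (mdifferentiableAt_of_contMDiffAt_top hΦZ),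
    h.leviCivita_Φ (mdifferentiableAt_of_contMDiffAt_top hZ), h.cov_ξ, inner_sub_right,
    inner_add_right, real_inner_smul_right, real_inner_smul_right, h.inner_ξ]
  module

theorem IsKenmotsu.curvature_Φ (h : IsKenmotsu I Φ ξ η)
    {X Y Z : Π x : M, TangentSpace I x} {x : M}
    (hX : CMDiffAt ∞ (T% X) x) (hY : CMDiffAt ∞ (T% Y) x) (hZ : CMDiffAt ∞ (T% Z) x) :
    curvature I X Y (fun y ↦ Φ y (Z y)) x = Φ x (curvature I X Y Z x)
      + inner ℝ (Y x) (Z x) • Φ x (X x) - inner ℝ (X x) (Z x) • Φ x (Y x)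
      + inner ℝ (X x) (Φ x (Z x)) • Y x - inner ℝ (Y x) (Φ x (Z x)) • X x := by
  have hs : inner ℝ (Y x) (Φ x (X x)) = -inner ℝ (X x) (Φ x (Y x)) := by
    rw [h.inner_Φ, real_inner_comm]
  rw [curvature, h.leviCivita_leviCivita_Φ hX hY hZ, h.leviCivita_leviCivita_Φ hY hX hZ,
    h.leviCivita_Φ (mdifferentiableAt_of_contMDiffAt_top hZ), hs, curvature,
    ← leviCivita_sub_eq_mlieBracket (mdifferentiableAt_of_contMDiffAt_top hX)
      (mdifferentiableAt_of_contMDiffAt_top hY)]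
  simp only [map_sub, inner_sub_left]
  module

theorem IsKenmotsu.starRicci_eq (h : IsKenmotsu I Φ ξ η) (x : M) (u v : TangentSpace I x) :
    starRicci I Φ x u v = ricci I x u v + (Module.finrank ℝ E - 2) * inner ℝ u v
      + η x u * η x v := by
  have key := starRicci_trace_eq (stdOrthonormalBasis ℝ (TangentSpace I x))
    (R := curvatureAt I x) (Φ := (Φ x).toLinearMap) (ξ := ξ x) (η := (η x).toLinearMap)
    (curvatureAt_add_left x) (curvatureAt_smul_left x) (curvatureAt_swap x)
    (inner_curvatureAt_skew x) (curvatureAt_bianchi x) (h.inner_Φ x) (h.inner_Φ_Φ x)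
    (h.inner_ξ x) (h.η_ξ x)
    (fun u v ↦ by
      have h1 := h.curvature_ξ (contMDiffAt_extend I E u) (contMDiffAt_extend I E v)
      rw [curvature_extend_eq_curvatureAt u v h.smooth_ξ.contMDiffAt] at h1
      simpa using h1)
    (fun u v w ↦ by
      have hw := contMDiffAt_extend (k := ∞) I E w
      have h1 := h.curvature_Φ (contMDiffAt_extend I E u) (contMDiffAt_extend I E v) hw
      rw [curvature_extend_eq_curvatureAt u v hw,
        curvature_extend_eq_curvatureAt u v (h.contMDiffAt_Φ hw)] at h1
      simpa using h1) u v
  rw [Fintype.card_fin] at key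
  exact key

theorem IsKenmotsu.starScalarCurvature_eq (h : IsKenmotsu I Φ ξ η) (x : M) :
    starScalarCurvature I Φ x =
      scalarCurvature I x + (Module.finrank ℝ E - 2) * Module.finrank ℝ E + 1 := by
  have s : ∑ i, η x (stdOrthonormalBasis ℝ (TangentSpace I x) i) *
      η x (stdOrthonormalBasis ℝ (TangentSpace I x) i) = 1 := by
    have := sum_inner_mul_apply (stdOrthonormalBasis ℝ (TangentSpace I x)) (η x).toLinearMap (ξ x)
    simpa [h.inner_ξ, h.η_ξ] using this
  have hd : Module.finrank ℝ (TangentSpace I x) = Module.finrank ℝ E := rfl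
  simp only [starScalarCurvature, scalarCurvature, metricTrace, h.starRicci_eq,
    Finset.sum_add_distrib, s, ← Finset.mul_sum]
  simp [hd]

end Kenmotsu

end KenmotsuGeometry

theorem mainTheorem1 (n : ℕ) {M : Type*} [TopologicalSpace M]
    [ChartedSpace (EuclideanSpace ℝ (Fin (2 * n + 1))) M] [IsManifold (𝓡 (2 * n + 1)) ∞ M]
    [RiemannianBundle (fun x : M ↦ TangentSpace (𝓡 (2 * n + 1)) x)]
    [IsContMDiffRiemannianBundle (𝓡 (2 * n + 1)) ∞ (EuclideanSpace ℝ (Fin (2 * n + 1)))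
      (fun x : M ↦ TangentSpace (𝓡 (2 * n + 1)) x)]
    (Φ : Π x : M, TangentSpace (𝓡 (2 * n + 1)) x →L[ℝ] TangentSpace (𝓡 (2 * n + 1)) x)
    (ξ : Π x : M, TangentSpace (𝓡 (2 * n + 1)) x)
    (η : Π x : M, TangentSpace (𝓡 (2 * n + 1)) x →L[ℝ] ℝ)
    (hK : KenmotsuGeometry.IsKenmotsu (𝓡 (2 * n + 1)) Φ ξ η)
    (z : Π x : M, TangentSpace (𝓡 (2 * n + 1)) x) (Ω ω₀ : ℝ)
    (hz : KenmotsuGeometry.IsStarRicciBourguignonSoliton (𝓡 (2 * n + 1)) Φ z Ω ω₀) :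
    KenmotsuGeometry.IsEtaRicciBourguignonSoliton (𝓡 (2 * n + 1)) η z
      (Ω - (2 * (n : ℝ) - 1) + 4 * ω₀ * (n : ℝ) ^ 2) (-1) ω₀ := by
  refine ⟨hz.smooth, fun x X Y hX hY ↦ ?_⟩
  have h := hz.soliton_eq x X Y hX hY
  rw [hK.starRicci_eq, hK.starScalarCurvature_eq, finrank_euclideanSpace_fin] at h
  push_cast at h
  linear_combination h
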